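/- Let $G=(V,E)$ be an undirected graph on $V=\{0,1,\dots,K+1\}$ (transmitter $0$, receiver $K+1$, relays $1,\dots,K$; every node has one antenna and power constraint $P$). The reciprocal channel gains $h_e$, $e\in E$, are independent $\mathcal{CN}(0,1)$ and stay constant during a block. A random sequential (RS) amplify-and-forward scheme with $L\ge 1$ paths and $S$ slots consists of - a sequence $(\mathrm p_1,\dots,\mathrm p_L)$ of (self-avoiding) paths $\mathrm p_i=(\mathrm p_i(0),\dots,\mathrm p_i(l_i))$ in $G$ from $0$ to $K+1$, repetitions being allowed; - slots $s_{i,j}\in\{1,\dots,S\}$ ($1\le i\le L$, $1\le j\le l_i$) such that (a) $s_{i,1}<s_{i',1}$ for $i<i'$; (b) $s_{i,j}<s_{i,j'}$ for $j<j'$; (c) $\{\mathrm p_i(j),\mathrm p_{i'}(j'-1)\}\notin E$ whenever $i<i'$ and $s_{i,j}=s_{i',j'}$; (d) no node receives and transmits in the same slot (half-duplex): $\mathrm p_i(j)\ne \mathrm p_{i'}(j'-1)$ whenever $s_{i,j}=s_{i',j'}$. In slot $s_{i,j}$ the node $\mathrm p_i(j)$ receives from $\mathrm p_i(j-1)$: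 its received signal is the sum, over all nodes $w$ adjacent to it which transmit in this slot, of $h_{\{\mathrm p_i(j),w\}}$ times the signal sent by $w$, plus independent $\mathcal{CN}(0,1)$ noise. Node $0$ sends the $i$-th input $x_i$ in slot $s_{i,1}$, the inputs being independent $\mathcal{CN}(0,P)$. For $j<l_i$ the relay $\mathrm p_i(j)$ sends, in slot $s_{i,j+1}$, the signal it received in slot $s_{i,j}$, multiplied by a random phase $u_{i,j}$ (independent, uniform on the unit circle, known at the receiver) and by the amplification coefficient $\alpha_{i,j}=\min\{1,\sqrt{P/W_{i,j}}\}$. Here $W_{i,j}$ is the power of the received signal, determined by either one of the following two rules: exactly, for the given channel realization and phases; or as $1+P\sum_w|h_{\{\mathrm p_i(j),w\}}|^2$, summed over the adjacent nodes $w$ that transmit in slot $s_{i,j}$. Let $y_i$ be the signal received by node $K+1$ in slot $s_{i,l_i}$, and write $\mathbf y=\mathbf H_T\mathbf x+\mathbf Q\mathbf n$, where $\mathbf n$ is the vector of all noises. At multiplexing gain $r\ge 0$ the transmission rate $R(P)$ in bits per symbol satisfies $R(P)/\log_2 P\to r$ as $P\to\infty$ (for instance $R(P)=r\log_2P$), the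 outage event is $$\mathcal E_P=\left\{\log_2\left|\mathbf I_L+P\,\mathbf H_T\mathbf H_T^H(\mathbf Q\mathbf Q^H)^{-1}\right|\le S\,R(P)\right\},$$ and the diversity gain is $d_{RS}(r)=\liminf_{P\to\infty}\bigl(-\log\mathbb P\{\mathcal E_P\}/\log P\bigr)\in[0,\infty]$. Let $\beta_e$ be the number of indices $i\in\{1,\dots,L\}$ for which $\mathrm p_i$ goes through the edge $e$. Then, for every such network, scheme, $r\ge0$ and $R$, and under either of the two rules, $$d_{RS}(r)\;\ge\;\frac{L}{\max_{e\in E}\beta_e}\left(1-\frac SL\,r\right)^+ .$$ -/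

import Mathlib

open MeasureTheory ProbabilityTheory Filter Topology

noncomputable section

/-- The circularly symmetric complex Gaussian law `CN(0, 1)`: independent real and imaginary parts
of variance `1/2`. The modulus of such a variable is Rayleigh distributed. -/
def complexGaussian : Measure ℂ :=
  ((gaussianReal 0 (1 / 2)).prod (gaussianReal 0 (1 / 2))).map
    (fun p : ℝ × ℝ => (p.1 : ℂ) + (p.2 : ℂ) * Complex.I)

/-- A single-antenna relay network with `K` relays is a simple graph on the nodes `0, …, K + 1`;
node `0` is the transmitter and node `K + 1`, that is `Fin.last (K + 1)`, is the receiver. -/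
abbrev RelayGraph (K : ℕ) := SimpleGraph (Fin (K + 2))

/-- The choices that define a random sequential (RS) scheme with `L` paths and `S` slots:
the path sequence and the timing sequence. Hop `j` of path `i`, with `j = 0, …, lᵢ - 1`, leads from
the `j`-th to the `(j+1)`-st node of the path, and takes place in the slot `slot i j`. -/
structure RSScheme {K : ℕ} (G : RelayGraph K) (L S : ℕ) where
  /-- The path sequence; a path may occur several times. -/
  path : Fin L → G.Path 0 (Fin.last (K + 1))
  /-- The timing sequence; all slots lie among the `S` slots of the block. -/
  slot : (i : Fin L) → Fin (path i).1.length → Fin S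
  /-- The transmitter sends the portions of the codeword in their order. -/
  ordered : ∀ i i' : Fin L, i < i' → ∀ j j', j.val = 0 → j'.val = 0 → slot i j < slot i' j'
  /-- Each signal travels causally along its path. -/
  causal : ∀ (i : Fin L) (j j'), j < j' → slot i j < slot i j'
  /-- No noncausal interference: a later path never disturbs a simultaneous hop of an earlier
  one. -/
  noNoncausal : ∀ i i' : Fin L, i < i' → ∀ j j', slot i j = slot i' j' →
    ¬ G.Adj ((path i).1.getVert (j.val + 1)) ((path i').1.getVert j'.val)
  /-- Half-duplex operation: no node receives and transmits in the same slot. -/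
  halfDuplex : ∀ (i i' : Fin L) (j j'), slot i j = slot i' j' →
    (path i).1.getVert (j.val + 1) ≠ (path i').1.getVert j'.val

/-- Two ways in which a relay may determine the power of the signal it receives, and hence its
amplification coefficient. -/
inductive PowerRule
  /-- The exact power of the received signal, averaged over codebook and noise for the given channel
  realization. -/
  | exact
  /-- The power computed from the gains of the relay's incoming channels alone, each active neighbour
  being taken to transmit an uncorrelated signal of power `P`. -/
  | nominal

namespace RSScheme

variable {K : ℕ} {G : RelayGraph K} {L S : ℕ}

/-- The hops `(i, j)` of all paths in the sequence. -/
abbrev Hop (c : RSScheme G L S) : Type := Σ i : Fin L, Fin (c.path i).1.length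

/-- The slot of a hop. -/
def hopSlot (c : RSScheme G L S) (a : c.Hop) : Fin S := c.slot a.1 a.2

/-- The node that transmits in a hop. -/
def tx (c : RSScheme G L S) (a : c.Hop) : Fin (K + 2) := (c.path a.1).1.getVert a.2.val

/-- The node that receives in a hop. -/
def rx (c : RSScheme G L S) (a : c.Hop) : Fin (K + 2) := (c.path a.1).1.getVert (a.2.val + 1)

theorem length_pos (c : RSScheme G L S) (i : Fin L) : 0 < (c.path i).1.length := by
  rcases Nat.eq_zero_or_pos (c.path i).1.length with h | h
  · exact absurd (SimpleGraph.Walk.eq_of_length_eq_zero h) (Fin.last_pos).ne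
  · exact h

/-- The last hop of path `i`, in which the receiver obtains the output of the path. -/
def lastHop (c : RSScheme G L S) (i : Fin L) : c.Hop :=
  ⟨i, ⟨(c.path i).1.length - 1, Nat.sub_lt (c.length_pos i) Nat.one_pos⟩⟩

/-- The hop before `a` on the same path (to be used when `a` is not the first hop). -/
def prevHop (c : RSScheme G L S) (a : c.Hop) : c.Hop :=
  ⟨a.1, ⟨a.2.val - 1, lt_of_le_of_lt (Nat.sub_le _ _) a.2.isLt⟩⟩

theorem hopSlot_prevHop (c : RSScheme G L S) (a : c.Hop) (ha : 0 < a.2.val) :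
    c.hopSlot (c.prevHop a) < c.hopSlot a :=
  c.causal a.1 _ _ (Fin.lt_def.2 (Nat.sub_lt ha Nat.one_pos))

/-- `β_e`: the number of paths in the path sequence that go through the edge `e`. -/
def load (c : RSScheme G L S) (e : Sym2 (Fin (K + 2))) : ℕ :=
  (Finset.univ.filter fun i : Fin L => e ∈ (c.path i).1.edges).card

variable [DecidableRel G.Adj]

/-- `max_{e ∈ E} β_e`. -/
def maxLoad (c : RSScheme G L S) : ℕ := G.edgeFinset.sup c.load

/-- The (reciprocal) channel gain between two nodes; it is `0` if there is no link. -/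
def chan (h : G.edgeSet → ℂ) (v w : Fin (K + 2)) : ℂ :=
  if hvw : G.Adj v w then h ⟨s(v, w), hvw⟩ else 0

/-- All signals are linear combinations of the transmitter's inputs `x_l` (`l = 1, …, L`, the symbols
of the portions of the codeword) and of the noises `n_a` (`a` a hop), and are represented by their
coefficients. This is the power of a signal when the inputs have power `P`, the noises have power
`1`, and all are uncorrelated. -/
def signalPower (c : RSScheme G L S) (P : ℝ) (z : Fin L ⊕ c.Hop → ℂ) : ℝ :=
  P * ∑ l, ‖z (.inl l)‖ ^ 2 + ∑ a, ‖z (.inr a)‖ ^ 2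

/-- The received power in hop `a` computed from the incoming channels: `1 + P ∑ |h|²`, where the sum
is over all nodes that transmit in the same slot. -/
def nominalPower (c : RSScheme G L S) (P : ℝ) (h : G.edgeSet → ℂ) (a : c.Hop) : ℝ :=
  1 + P * ∑ b, if c.hopSlot b = c.hopSlot a then ‖chan h (c.rx a) (c.tx b)‖ ^ 2 else 0

/-- The amplification coefficient at the receiving relay of hop `a`, when the received signal is `z`:
the largest `α ≤ 1` for which the output power is at most `P`. -/
def amplification (c : RSScheme G L S) (rule : PowerRule) (P : ℝ) (h : G.edgeSet → ℂ)
    (a : c.Hop) (z : Fin L ⊕ c.Hop → ℂ) : ℝ :=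
  min 1 (√(P / (match rule with
    | .exact => c.signalPower P z
    | .nominal => c.nominalPower P h a)))

/-- The signal received in hop `a` by the node `c.rx a`: the noise at that node, plus, for every hop
`b` in the same slot, the signal sent by `c.tx b`, times the gain of the channel between the two
nodes. The transmitter sends the input `x_i` in the first hop of path `i`; a relay sends what it
received in the previous hop of the path, multiplied by its random unitary scalar `u` and by the
amplification coefficient. (The values of `u` at the last hops of the paths are not used.) -/
def received (c : RSScheme G L S) (rule : PowerRule) (P : ℝ) (h : G.edgeSet → ℂ)
    (u : c.Hop → Circle) (a : c.Hop) : Fin L ⊕ c.Hop → ℂ :=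
  Pi.single (.inr a) 1 + ∑ b : c.Hop,
    if hab : c.hopSlot b = c.hopSlot a then
      chan h (c.rx a) (c.tx b) •
        (if hb : 0 < b.2.val then
          ((c.amplification rule P h (c.prevHop b) (received c rule P h u (c.prevHop b)) : ℂ) *
            (u (c.prevHop b) : ℂ)) • received c rule P h u (c.prevHop b)
        else Pi.single (.inl b.1) 1)
    else 0
termination_by (c.hopSlot a).val
decreasing_by
  all_goals
    rw [← hab]
    exact c.hopSlot_prevHop b hb

/-- The end-to-end channel matrix `H_T`: entry `(i, l)` relates the input `x_l` to the output of
path `i`. -/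
def channelMatrix (c : RSScheme G L S) (rule : PowerRule) (P : ℝ) (h : G.edgeSet → ℂ)
    (u : c.Hop → Circle) : Matrix (Fin L) (Fin L) ℂ :=
  Matrix.of fun i l => c.received rule P h u (c.lastHop i) (.inl l)

/-- The matrix `Q` that relates the noises to the outputs of the paths. -/
def noiseMatrix (c : RSScheme G L S) (rule : PowerRule) (P : ℝ) (h : G.edgeSet → ℂ)
    (u : c.Hop → Circle) : Matrix (Fin L) c.Hop ℂ :=
  Matrix.of fun i a => c.received rule P h u (c.lastHop i) (.inr a)

/-- The mutual information in bits (per symbol of a slot) between the inputs, which are independent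
`CN(0, P)` variables, and the outputs of the paths, for a given realization of the channels:
`log₂ |I + P H_T H_Tᴴ P_n⁻¹|` with the noise covariance `P_n = Q Qᴴ`. -/
def mutualInfo (c : RSScheme G L S) (rule : PowerRule) (P : ℝ) (h : G.edgeSet → ℂ)
    (u : c.Hop → Circle) : ℝ :=
  let H := c.channelMatrix rule P h u
  let Q := c.noiseMatrix rule P h u
  Real.logb 2 (1 + (P : ℂ) • (H * H.conjTranspose * (Q * Q.conjTranspose)⁻¹)).det.re

/-- The joint law of the channel gains, which are independent `CN(0, 1)`, and of the arguments
(divided by `2π`) of the random unitary scalars, which are independent and uniform on `(0, 1]`. -/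
def law (c : RSScheme G L S) : Measure ((G.edgeSet → ℂ) × (c.Hop → ℝ)) :=
  (Measure.pi fun _ => complexGaussian).prod
    (Measure.pi fun _ => (volume : Measure ℝ).restrict (Set.Ioc 0 1))

/-- The outage probability at the rate of `R` bits per symbol of a block of `S` slots. -/
def outageProb (c : RSScheme G L S) (rule : PowerRule) (P R : ℝ) : ENNReal :=
  c.law {ω | c.mutualInfo rule P ω.1 (fun a => Circle.exp (2 * Real.pi * ω.2 a)) ≤ S * R}

/-- The diversity gain `- lim log ℙ{outage} / log P` as `P → ∞` (as a lower limit, in the extended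
reals), if the rate `R P` is used at power `P`. -/
def diversityGain (c : RSScheme G L S) (rule : PowerRule) (R : ℝ → ℝ) : EReal :=
  liminf (fun P : ℝ => -(c.outageProb rule P (R P)).log / ((Real.log P : ℝ) : EReal)) atTop

end RSScheme

end

/-! A later path never disturbs an earlier one, so `H_T` is lower triangular. Its diagonal entries
are the products of the gains along the paths, times phases and amplification coefficients, and
`|det H_T|²` is, up to these coefficients, `∏ |h_e|^(2 k_e)`, where `k_e` counts the hops over `e`.
Paths are self-avoiding, so `k_e ≤ β_e`.

For invertible `H_T`, `P^L |det H_T|² ≤ det(I + P H_T H_Tᴴ N⁻¹) det N` with `N = Q Qᴴ`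
(`Matrix.PosDef.le_re_det_one_add`). The determinant of `N` and the inverse amplifications are
bounded by polynomials in `∏ (1 + |h_e|)`, uniformly in `P ≥ 1` and in the phases. Outage therefore
forces `∏ |h_e|^(2 k_e) ≤ C 2^(S R) P^(-L) ∏ (1 + |h_e|)^m` (`exists_prod_le_of_outage`).

Markov's inequality for the power `-s` of the product bounds the probability of this event by a
multiple of `(2^(S R) P^(-L))^s` whenever `s k_e < 1` for all `e`, because a complex Gaussian has
finite moments of every order above `-2`. The polynomial weights are absorbed by the Gaussian tails.
The resulting exponent is `s (L - S r)`, and `s` may approach `1 / max β_e`. -/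

open scoped ENNReal

/-! ### Negative moments of Gaussian variables and a Chernoff bound -/

/-- The integrability over `ℝ` of an even function follows from that over the positive half-line. -/
theorem integrable_comp_abs_of_integrableOn_Ioi {f : ℝ → ℝ} (hf : IntegrableOn f (Set.Ioi 0)) :
    Integrable fun x : ℝ => f |x| := by
  have h1 : IntegrableOn (fun x : ℝ => f |x|) (Set.Ioi 0) :=
    hf.congr_fun (fun x hx => by simp only [abs_of_pos (Set.mem_Ioi.1 hx)]) measurableSet_Ioi
  rw [← integrableOn_univ, ← Set.Iio_union_Ici (a := (0 : ℝ)), integrableOn_union,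
    integrableOn_Ici_iff_integrableOn_Ioi]
  refine ⟨?_, h1⟩
  rw [← (Measure.measurePreserving_neg (volume : Measure ℝ)).integrableOn_comp_preimage
      (Homeomorph.neg ℝ).measurableEmbedding]
  simpa [Function.comp_def] using h1

/-- Moments of order `> -1` of a Gaussian variable are finite, also with polynomial weights. -/
theorem lintegral_gaussianReal_rpow_lt_top {q : ℝ} (hq : q < 1) (M : ℕ) :
    ∫⁻ x : ℝ, ‖x‖ₑ ^ (-q) * (1 + ‖x‖ₑ) ^ M ∂(gaussianReal 0 (1 / 2)) < ∞ := by
  have hmeas : Measurable fun x : ℝ => ‖x‖ₑ ^ (-q) * (1 + ‖x‖ₑ) ^ M := by fun_prop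
  rw [gaussianReal_of_var_ne_zero _ (by norm_num),
    lintegral_withDensity_eq_lintegral_mul _ (measurable_gaussianPDF _ _) hmeas]
  have hint : Integrable fun x : ℝ => ∑ k ∈ Finset.range (M + 1),
      (M.choose k : ℝ) * (|x| ^ (-q + (k : ℝ)) * Real.exp (-1 * |x| ^ 2)) := by
    refine integrable_finsetSum _ fun k _ => Integrable.const_mul ?_ _
    exact integrable_comp_abs_of_integrableOn_Ioi (f := fun x => x ^ (-q + (k : ℝ)) *
      Real.exp (-1 * x ^ 2)) (integrableOn_rpow_mul_exp_neg_mul_sq one_pos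
        (by have : (0 : ℝ) ≤ k := Nat.cast_nonneg k
            linarith))
  have hlt := (hint.const_mul (√(2 * Real.pi * (1 / 2)))⁻¹).lintegral_lt_top
  refine lt_of_le_of_lt (le_of_eq (lintegral_congr_ae ?_)) hlt
  -- For positive `q` the extended power `‖x‖ₑ ^ (-q)` is infinite at `0`, unlike the real one.
  have h0 : ∀ᵐ x : ℝ, x ≠ 0 := by simp [ae_iff]
  filter_upwards [h0] with x hx
  have hx' : 0 < |x| := abs_pos.2 hx
  have hex : ∀ k ∈ Finset.range (M + 1), (M.choose k : ℝ) * (|x| ^ (-q + (k : ℝ)) *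
      Real.exp (-1 * |x| ^ 2)) = Real.exp (-1 * |x| ^ 2) * |x| ^ (-q) *
        (|x| ^ k * 1 ^ (M - k) * (M.choose k : ℝ)) := by
    intro k _
    rw [Real.rpow_add hx', Real.rpow_natCast]
    ring
  rw [Finset.sum_congr rfl hex, ← Finset.mul_sum, ← add_pow]
  have he : ‖x‖ₑ = ENNReal.ofReal |x| := by rw [← ofReal_norm, Real.norm_eq_abs]
  simp only [Pi.mul_apply, gaussianPDF, gaussianPDFReal]
  rw [he, ENNReal.ofReal_rpow_of_pos hx', ← ENNReal.ofReal_one,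
    ← ENNReal.ofReal_add zero_le_one hx'.le, ← ENNReal.ofReal_pow (by positivity),
    ← ENNReal.ofReal_mul (by positivity), ← ENNReal.ofReal_mul (by positivity)]
  congr 1
  have hs : ((1 / 2 : NNReal) : ℝ) = 1 / 2 := by norm_num
  rw [hs, sq_abs]
  have : -(x - 0) ^ 2 / (2 * (1 / 2)) = -1 * x ^ 2 := by ring
  rw [this]
  ring

theorem measurable_ofReal_add_mul_I :
    Measurable fun p : ℝ × ℝ => (p.1 : ℂ) + (p.2 : ℂ) * Complex.I := by fun_prop

instance isProbabilityMeasure_complexGaussian : IsProbabilityMeasure complexGaussian :=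
  Measure.isProbabilityMeasure_map measurable_ofReal_add_mul_I.aemeasurable

/-- Moments of order `> -2` of a complex Gaussian variable are finite, also with polynomial
weights. -/
theorem lintegral_complexGaussian_rpow_lt_top {q : ℝ} (hq0 : 0 ≤ q) (hq : q < 1) (M : ℕ) :
    ∫⁻ z : ℂ, (‖z‖ₑ ^ 2) ^ (-q) * (1 + ‖z‖ₑ) ^ M ∂complexGaussian < ∞ := by
  rw [complexGaussian, lintegral_map (by fun_prop) measurable_ofReal_add_mul_I]
  have hmeas : Measurable fun x : ℝ => ‖x‖ₑ ^ (-q) * (1 + ‖x‖ₑ) ^ M := by fun_prop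
  calc _ ≤ ∫⁻ p : ℝ × ℝ, (‖p.1‖ₑ ^ (-q) * (1 + ‖p.1‖ₑ) ^ M) *
        (‖p.2‖ₑ ^ (-q) * (1 + ‖p.2‖ₑ) ^ M)
          ∂((gaussianReal 0 (1 / 2)).prod (gaussianReal 0 (1 / 2))) := by
        refine lintegral_mono fun p => ?_
        -- Since `|x| |y| ≤ x² + y²`, the negative power splits into independent real factors of
        -- order `-q > -1`.
        have hlow : ‖p.1‖ₑ * ‖p.2‖ₑ ≤ ‖(p.1 : ℂ) + (p.2 : ℂ) * Complex.I‖ₑ ^ 2 := by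
          simp only [← ofReal_norm]
          rw [← ENNReal.ofReal_mul (norm_nonneg _), ← ENNReal.ofReal_pow (norm_nonneg _)]
          refine ENNReal.ofReal_le_ofReal ?_
          rw [← Complex.normSq_eq_norm_sq, Complex.normSq_add_mul_I, Real.norm_eq_abs,
            Real.norm_eq_abs, ← sq_abs p.1, ← sq_abs p.2]
          nlinarith [sq_nonneg (|p.1| - |p.2|), abs_nonneg p.1, abs_nonneg p.2]
        have hup : 1 + ‖(p.1 : ℂ) + (p.2 : ℂ) * Complex.I‖ₑ ≤ (1 + ‖p.1‖ₑ) * (1 + ‖p.2‖ₑ) := by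
          have h1 : ‖(p.1 : ℂ) + (p.2 : ℂ) * Complex.I‖ₑ ≤ ‖p.1‖ₑ + ‖p.2‖ₑ := by
            refine (enorm_add_le _ _).trans (le_of_eq ?_)
            simp [← ofReal_norm]
          calc _ ≤ 1 + (‖p.1‖ₑ + ‖p.2‖ₑ) := by gcongr
            _ ≤ 1 + (‖p.1‖ₑ + ‖p.2‖ₑ) + ‖p.1‖ₑ * ‖p.2‖ₑ := le_self_add
            _ = _ := by ring
        calc _ ≤ (‖p.1‖ₑ * ‖p.2‖ₑ) ^ (-q) * ((1 + ‖p.1‖ₑ) * (1 + ‖p.2‖ₑ)) ^ M := by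
              refine mul_le_mul' ?_ (pow_le_pow_left' hup M)
              rw [ENNReal.rpow_neg, ENNReal.rpow_neg, ENNReal.inv_le_inv]
              exact ENNReal.rpow_le_rpow hlow hq0
          _ = _ := by
              rw [ENNReal.mul_rpow_of_ne_top enorm_ne_top enorm_ne_top, mul_pow]
              ring
    _ < ∞ := by
        rw [lintegral_prod_mul hmeas.aemeasurable hmeas.aemeasurable]
        exact ENNReal.mul_lt_top (lintegral_gaussianReal_rpow_lt_top hq M)
          (lintegral_gaussianReal_rpow_lt_top hq M)

/-- A Chernoff bound for products of independent complex Gaussian variables: such a product, with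
multiplicities `k e`, is rarely small, even in comparison to powers of the variables. -/
theorem exists_measure_prod_enorm_le {ι : Type*} [Fintype ι] (k : ι → ℕ) (m : ℕ) {s : ℝ}
    (hs : 0 ≤ s) (hk : ∀ e, s * k e < 1) :
    ∃ C : ℝ, 0 < C ∧ ∀ t : ℝ, 0 < t →
      (Measure.pi fun _ : ι => complexGaussian)
        {h | ∏ e, ‖h e‖ ^ (2 * k e) ≤ t * ∏ e, (1 + ‖h e‖) ^ m} ≤ ENNReal.ofReal (C * t ^ s) := by
  -- Rounding `m * s` up keeps the weights natural powers after the `s`-th power is taken.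
  obtain ⟨M, hM⟩ := exists_nat_ge (m * s)
  set g : ι → ℂ → ℝ≥0∞ := fun e z => (‖z‖ₑ ^ 2) ^ (-(s * k e)) * (1 + ‖z‖ₑ) ^ M with hg
  have hgm : ∀ e, Measurable (g e) := fun e => by simp only [hg]; fun_prop
  set I : ℝ≥0∞ := ∏ e, ∫⁻ z, g e z ∂complexGaussian with hI
  have hIlt : I < ∞ := ENNReal.prod_lt_top fun e _ =>
    lintegral_complexGaussian_rpow_lt_top (by positivity) (hk e) M
  have hint : ∫⁻ h, ∏ e, g e (h e) ∂(Measure.pi fun _ : ι => complexGaussian) = I := by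
    rw [lintegral_prod_eq_prod_lintegral_of_indepFun Finset.univ (fun e (h : ι → ℂ) => g e (h e))
      (iIndepFun_pi fun e => (hgm e).aemeasurable) fun e => (hgm e).comp (measurable_pi_apply e)]
    refine Finset.prod_congr rfl fun e _ => ?_
    exact (measurePreserving_eval (fun _ : ι => complexGaussian) e).lintegral_comp (hgm e)
  -- The summand `1` only serves to make the constant positive.
  refine ⟨I.toReal + 1, by positivity, fun t ht => ?_⟩
  have ht0 : ENNReal.ofReal t ≠ 0 := by simpa using ht
  have hsub : {h : ι → ℂ | ∏ e, ‖h e‖ ^ (2 * k e) ≤ t * ∏ e, (1 + ‖h e‖) ^ m} ⊆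
      {h | 1 ≤ ENNReal.ofReal t ^ s * ∏ e, g e (h e)} := by
    intro h hh
    have h1 : ∏ e, (‖h e‖ₑ ^ 2) ^ k e ≤ ENNReal.ofReal t * ∏ e, (1 + ‖h e‖ₑ) ^ m := by
      have := ENNReal.ofReal_le_ofReal (Set.mem_ofPred_eq ▸ hh)
      rw [ENNReal.ofReal_mul ht.le, ENNReal.ofReal_prod_of_nonneg fun e _ => by positivity,
        ENNReal.ofReal_prod_of_nonneg fun e _ => by positivity] at this
      convert this using 2
      · rw [ENNReal.ofReal_pow (norm_nonneg _), ofReal_norm, pow_mul]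
      · refine Finset.prod_congr rfl fun e _ => ?_
        rw [ENNReal.ofReal_pow (by positivity), ENNReal.ofReal_add zero_le_one (norm_nonneg _),
          ofReal_norm, ENNReal.ofReal_one]
    have h2 := ENNReal.rpow_le_rpow h1 hs
    have hfin : ∀ e, (‖h e‖ₑ ^ 2) ^ k e ≠ ∞ := fun e => by finiteness
    have hinv : ((∏ e, (‖h e‖ₑ ^ 2) ^ k e) ^ s)⁻¹ = ∏ e, (‖h e‖ₑ ^ 2) ^ (-(s * k e)) := by
      rw [← ENNReal.prod_rpow_of_nonneg hs, ENNReal.prod_inv_distrib]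
      · refine Finset.prod_congr rfl fun e _ => ?_
        rw [ENNReal.rpow_neg, ← ENNReal.rpow_natCast, ← ENNReal.rpow_mul, mul_comm s]
      · exact fun i _ j _ _ => Or.inr (ENNReal.rpow_ne_top_of_nonneg hs (hfin j))
    have hX : (∏ e, (‖h e‖ₑ ^ 2) ^ k e) ^ s ≠ ∞ :=
      ENNReal.rpow_ne_top_of_nonneg hs (ENNReal.prod_ne_top fun e _ => hfin e)
    have hY : (∏ e, (1 + ‖h e‖ₑ) ^ m) ^ s ≤ ∏ e, (1 + ‖h e‖ₑ) ^ M := by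
      rw [← ENNReal.prod_rpow_of_nonneg hs]
      refine Finset.prod_le_prod' fun e _ => ?_
      rw [← ENNReal.rpow_natCast, ← ENNReal.rpow_mul, ← ENNReal.rpow_natCast]
      exact ENNReal.rpow_le_rpow_of_exponent_le le_self_add hM
    have h3 : (∏ e, (‖h e‖ₑ ^ 2) ^ k e) ^ s ≤
        ENNReal.ofReal t ^ s * ∏ e, (1 + ‖h e‖ₑ) ^ M := by
      rw [ENNReal.mul_rpow_of_nonneg _ _ hs] at h2
      exact h2.trans (mul_le_mul_right hY _)
    -- The product of the gains may vanish and its inverse be infinite; the division remains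
    -- legitimate because this side is nonzero.
    have hY0 : ENNReal.ofReal t ^ s * ∏ e, (1 + ‖h e‖ₑ) ^ M ≠ 0 := by
      refine mul_ne_zero ?_ ?_
      · exact (ENNReal.rpow_pos (pos_iff_ne_zero.2 ht0) ENNReal.ofReal_ne_top).ne'
      · exact Finset.prod_ne_zero_iff.2 fun e _ => pow_ne_zero _ (by simp)
    simp only [Set.mem_ofPred_eq, hg, Finset.prod_mul_distrib]
    rw [← hinv, mul_left_comm, mul_comm, ← div_eq_mul_inv]
    exact (ENNReal.le_div_iff_mul_le (Or.inr hY0) (Or.inl hX)).2 (by simpa using h3)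
  refine (measure_mono hsub).trans ?_
  have hmeas : Measurable fun h : ι → ℂ => ∏ e, g e (h e) :=
    Finset.measurable_fun_prod _ fun e _ => (hgm e).comp (measurable_pi_apply e)
  have hmk := mul_meas_ge_le_lintegral (μ := Measure.pi fun _ : ι => complexGaussian)
    (f := fun h => ENNReal.ofReal t ^ s * ∏ e, g e (h e))
    (hmeas.const_mul _) 1
  rw [one_mul, lintegral_const_mul _ hmeas, hint] at hmk
  refine hmk.trans ?_
  rw [ENNReal.ofReal_rpow_of_pos ht, mul_comm, ENNReal.ofReal_mul (by positivity)]
  gcongr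
  rw [← ENNReal.ofReal_toReal hIlt.ne]
  exact ENNReal.ofReal_le_ofReal (by simp)

/-! ### A determinant inequality for the mutual information -/

namespace Matrix

open scoped ComplexOrder

/-- Shifting a positive semidefinite matrix by `P` raises its determinant to at least `P ^ n`. -/
theorem PosSemidef.pow_le_re_det_add_smul_one {n : Type*} [Fintype n] [DecidableEq n]
    {M : Matrix n n ℂ} (hM : M.PosSemidef) {P : ℝ} (hP : 0 ≤ P) :
    ∃ x : ℝ, P ^ Fintype.card n ≤ x ∧ (M + (P : ℂ) • (1 : Matrix n n ℂ)).det = x := by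
  refine ⟨∏ i, (hM.1.eigenvalues i + P), ?_, ?_⟩
  · rw [← Finset.card_univ, ← Finset.prod_const]
    exact Finset.prod_le_prod (fun _ _ => hP) fun i _ => by
      have := hM.eigenvalues_nonneg i
      linarith
  -- The shifted determinant is, up to the sign `(-1)^n`, the characteristic polynomial at `-P`.
  · have h1 := M.eval_charpoly (-(P : ℂ))
    rw [hM.1.charpoly_eq, Polynomial.eval_prod] at h1
    have h2 : M + (P : ℂ) • (1 : Matrix n n ℂ) = -(scalar n (-(P : ℂ)) - M) := by
      rw [neg_sub, sub_eq_add_neg, smul_one_eq_diagonal]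
      simp [scalar_apply]
    rw [h2, det_neg, ← h1, ← Finset.card_univ, ← Finset.prod_const, ← Finset.prod_mul_distrib]
    push_cast
    refine Finset.prod_congr rfl fun i _ => ?_
    simp

/-- The log-det mutual information dominates the product of the signal gains over the noise
volume. -/
theorem PosDef.le_re_det_one_add {n : Type*} [Fintype n] [DecidableEq n]
    {N H : Matrix n n ℂ} (hN : N.PosDef) (hH : H.det ≠ 0) {P : ℝ} (hP : 0 ≤ P) :
    P ^ Fintype.card n * ‖H.det‖ ^ 2 ≤
      (1 + (P : ℂ) • (H * H.conjTranspose * N⁻¹)).det.re * ‖N.det‖ := by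
  have hHu : IsUnit H.det := isUnit_iff_ne_zero.2 hH
  have hHu' : IsUnit H.conjTranspose.det := by
    rw [det_conjTranspose]; exact hHu.star
  have hNu : IsUnit N.det := (isUnit_iff_isUnit_det _).1 hN.isUnit
  obtain ⟨y, hy, hNy⟩ : ∃ y : ℝ, 0 < y ∧ N.det = y :=
    ⟨∏ i, hN.1.eigenvalues i, Finset.prod_pos fun i _ => hN.eigenvalues_pos i, by
      rw [hN.1.det_eq_prod_eigenvalues]; simp⟩
  -- `N + P H Hᴴ = H (H⁻¹ N H⁻ᴴ + P) Hᴴ`, and the middle factor is a shifted positive semidefinite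
  -- matrix.
  have hM : (H⁻¹ * N * (H⁻¹).conjTranspose).PosSemidef :=
    hN.posSemidef.mul_mul_conjTranspose_same _
  obtain ⟨x, hx, hdx⟩ := hM.pow_le_re_det_add_smul_one hP
  have hfac : H * (H⁻¹ * N * (H⁻¹).conjTranspose + (P : ℂ) • (1 : Matrix n n ℂ)) *
      H.conjTranspose = N + (P : ℂ) • (H * H.conjTranspose) := by
    rw [mul_add, add_mul, conjTranspose_nonsing_inv]
    congr 1
    · rw [mul_assoc, mul_assoc, nonsing_inv_mul _ hHu', mul_one, ← mul_assoc,
        mul_nonsing_inv _ hHu, one_mul]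
    · simp
  have hfac2 : (1 + (P : ℂ) • (H * H.conjTranspose * N⁻¹)) * N =
      N + (P : ℂ) • (H * H.conjTranspose) := by
    rw [add_mul, one_mul, smul_mul_assoc, mul_assoc _ N⁻¹ N, nonsing_inv_mul _ hNu, mul_one]
  have hdet : (1 + (P : ℂ) • (H * H.conjTranspose * N⁻¹)).det * y = ((‖H.det‖ ^ 2 * x : ℝ) : ℂ) := by
    rw [← hNy, ← det_mul, hfac2, ← hfac, det_mul, det_mul, hdx, det_conjTranspose, mul_right_comm,
      Complex.star_def, Complex.mul_conj, Complex.normSq_eq_norm_sq]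
    push_cast
    ring
  have hre := congrArg Complex.re hdet
  rw [Complex.re_mul_ofReal, Complex.ofReal_re] at hre
  rw [hNy, Complex.norm_real, Real.norm_eq_abs, abs_of_pos hy, hre, mul_comm]
  gcongr

end Matrix

/-! ### Triangular structure of the received signals -/

namespace RSScheme

variable {K : ℕ} {G : RelayGraph K} {L S : ℕ}

theorem slot_pos (c : RSScheme G L S) (a : c.Hop) : 0 < S := (c.hopSlot a).pos

theorem eq_of_hopSlot_eq (c : RSScheme G L S) {a b : c.Hop} (hab : b.1 = a.1)
    (hs : c.hopSlot b = c.hopSlot a) : b = a := by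
  obtain ⟨i, j⟩ := a
  obtain ⟨i', j'⟩ := b
  obtain rfl : i' = i := hab
  have hs' : c.slot i' j' = c.slot i' j := hs
  rcases lt_trichotomy j' j with h | h | h
  · exact absurd hs' (c.causal i' _ _ h).ne
  · rw [h]
  · exact absurd hs' (c.causal i' _ _ h).ne'

theorem adj_rx_tx (c : RSScheme G L S) (a : c.Hop) : G.Adj (c.rx a) (c.tx a) :=
  ((c.path a.1).1.adj_getVert_succ a.2.isLt).symm

/-- The edge that a hop uses. -/
def hopEdge (c : RSScheme G L S) (a : c.Hop) : G.edgeSet := ⟨s(c.rx a, c.tx a), c.adj_rx_tx a⟩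

/-- The slots of a scheme allow for induction: a property of hops holds if it passes on from all
previous hops of the paths that are active in a slot. -/
theorem hop_induction (c : RSScheme G L S) {p : c.Hop → Prop}
    (hp : ∀ a, (∀ b, c.hopSlot b = c.hopSlot a → 0 < b.2.val → p (c.prevHop b)) → p a)
    (a : c.Hop) : p a := by
  induction hn : (c.hopSlot a).val using Nat.strong_induction_on generalizing a with
  | _ n ih =>
    refine hp a fun b hb hb0 => ih _ ?_ _ rfl
    rw [← hn, ← hb]
    exact c.hopSlot_prevHop b hb0

variable [DecidableRel G.Adj]

theorem chan_rx_tx (c : RSScheme G L S) (h : G.edgeSet → ℂ) (a : c.Hop) :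
    chan h (c.rx a) (c.tx a) = h (c.hopEdge a) := dif_pos (c.adj_rx_tx a)

theorem chan_eq_zero_of_lt (c : RSScheme G L S) (h : G.edgeSet → ℂ) {a b : c.Hop} (hab : a.1 < b.1)
    (hs : c.hopSlot b = c.hopSlot a) : chan h (c.rx a) (c.tx b) = 0 :=
  dif_neg (c.noNoncausal a.1 b.1 hab a.2 b.2 hs.symm)

/-- The dependent conditions of the recursion serve its termination; coefficientwise, plain ones
suffice. -/
theorem received_apply (c : RSScheme G L S) (rule : PowerRule) (P : ℝ) (h : G.edgeSet → ℂ)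
    (u : c.Hop → Circle) (a : c.Hop) (k : Fin L ⊕ c.Hop) :
    c.received rule P h u a k = (Pi.single (.inr a) 1 : Fin L ⊕ c.Hop → ℂ) k + ∑ b : c.Hop,
      if c.hopSlot b = c.hopSlot a then
        chan h (c.rx a) (c.tx b) *
          (if 0 < b.2.val then
            ((c.amplification rule P h (c.prevHop b) (c.received rule P h u (c.prevHop b)) : ℂ) *
              (u (c.prevHop b) : ℂ)) * c.received rule P h u (c.prevHop b) k
          else (Pi.single (.inl b.1) 1 : Fin L ⊕ c.Hop → ℂ) k)
      else 0 := by
  rw [received, Pi.add_apply, Finset.sum_apply]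
  congr 1
  refine Finset.sum_congr rfl fun b _ => ?_
  split_ifs <;> simp

/-- No signal depends on the inputs of later paths. -/
theorem received_inl_of_lt (c : RSScheme G L S) (rule : PowerRule) (P : ℝ) (h : G.edgeSet → ℂ)
    (u : c.Hop → Circle) (a : c.Hop) {l : Fin L} (hl : a.1 < l) :
    c.received rule P h u a (.inl l) = 0 := by
  induction a using c.hop_induction with
  | hp a ih =>
    rw [received_apply, Pi.single_eq_of_ne (by simp), zero_add]
    refine Finset.sum_eq_zero fun b _ => ?_
    split_ifs with hb hb0
    -- Paths up to that of `a` carry no input `l`, by induction; later ones are not heard in hop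
    -- `a`.
    · rcases le_or_gt b.1 a.1 with hba | hba
      · rw [ih b hb hb0 (lt_of_le_of_lt hba hl), mul_zero, mul_zero]
      · rw [c.chan_eq_zero_of_lt h hba hb, zero_mul]
    · rcases le_or_gt b.1 a.1 with hba | hba
      · rw [Pi.single_eq_of_ne, mul_zero]
        simpa using (lt_of_le_of_lt hba hl).ne'
      · rw [c.chan_eq_zero_of_lt h hba hb, zero_mul]
    · rfl

/-- Only the hop itself carries the input of its path. -/
theorem received_inl_self (c : RSScheme G L S) (rule : PowerRule) (P : ℝ) (h : G.edgeSet → ℂ)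
    (u : c.Hop → Circle) (a : c.Hop) :
    c.received rule P h u a (.inl a.1) = h (c.hopEdge a) *
      (if 0 < a.2.val then
        ((c.amplification rule P h (c.prevHop a) (c.received rule P h u (c.prevHop a)) : ℂ) *
          (u (c.prevHop a) : ℂ)) * c.received rule P h u (c.prevHop a) (.inl a.1)
      else 1) := by
  rw [received_apply, Pi.single_eq_of_ne (by simp), zero_add, Finset.sum_eq_single a, if_pos rfl,
    chan_rx_tx, Pi.single_eq_same]
  · intro b _ hba
    split_ifs with hb hb0
    -- An earlier path does not carry this input, a later one is not heard, and the path of `a`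
    -- itself is active only once per slot.
    · rcases lt_trichotomy b.1 a.1 with hlt | heq | hgt
      · rw [c.received_inl_of_lt rule P h u (c.prevHop b) hlt, mul_zero, mul_zero]
      · exact absurd (c.eq_of_hopSlot_eq heq hb) hba
      · rw [c.chan_eq_zero_of_lt h hgt hb, zero_mul]
    · rcases lt_trichotomy b.1 a.1 with hlt | heq | hgt
      · rw [Pi.single_eq_of_ne (by simpa using hlt.ne'), mul_zero]
      · exact absurd (c.eq_of_hopSlot_eq heq hb) hba
      · rw [c.chan_eq_zero_of_lt h hgt hb, zero_mul]
    · rfl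
  · simp

/-- No signal depends on the noises of other hops of the same slot, or of later slots. -/
theorem received_inr_of_le (c : RSScheme G L S) (rule : PowerRule) (P : ℝ) (h : G.edgeSet → ℂ)
    (u : c.Hop → Circle) (a : c.Hop) {b : c.Hop} (hab : c.hopSlot a ≤ c.hopSlot b) (hne : b ≠ a) :
    c.received rule P h u a (.inr b) = 0 := by
  induction a using c.hop_induction with
  | hp a ih =>
    rw [received_apply, Pi.single_eq_of_ne (by simpa using hne), zero_add]
    refine Finset.sum_eq_zero fun d _ => ?_
    split_ifs with hd hd0
    · have hlt : c.hopSlot (c.prevHop d) < c.hopSlot b :=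
        lt_of_lt_of_le (c.hopSlot_prevHop d hd0) (hd ▸ hab)
      rw [ih d hd hd0 hlt.le (by rintro rfl; exact lt_irrefl _ hlt), mul_zero, mul_zero]
    · simp
    · rfl

theorem received_inr_self (c : RSScheme G L S) (rule : PowerRule) (P : ℝ) (h : G.edgeSet → ℂ)
    (u : c.Hop → Circle) (a : c.Hop) : c.received rule P h u a (.inr a) = 1 := by
  rw [received_apply, Pi.single_eq_same, Finset.sum_eq_zero, add_zero]
  intro d _
  split_ifs with hd hd0
  · have hlt : c.hopSlot (c.prevHop d) < c.hopSlot a := hd ▸ c.hopSlot_prevHop d hd0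
    rw [c.received_inr_of_le rule P h u _ hlt.le (by rintro rfl; exact lt_irrefl _ hlt), mul_zero,
      mul_zero]
  · simp
  · rfl

/-- The noise at the receiver is not forwarded. -/
theorem received_inr_lastHop (c : RSScheme G L S) (rule : PowerRule) (P : ℝ) (h : G.edgeSet → ℂ)
    (u : c.Hop → Circle) (a : c.Hop) {i : Fin L} (hne : c.lastHop i ≠ a) :
    c.received rule P h u a (.inr (c.lastHop i)) = 0 := by
  induction a using c.hop_induction with
  | hp a ih =>
    rw [received_apply, Pi.single_eq_of_ne (by simpa using hne), zero_add]
    refine Finset.sum_eq_zero fun d _ => ?_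
    split_ifs with hd hd0
    · rw [ih d hd hd0, mul_zero, mul_zero]
      -- A hop preceding another on its path is not the last one.
      obtain ⟨i', j⟩ := d
      intro he
      simp only [lastHop, prevHop, Sigma.mk.injEq] at he
      obtain ⟨rfl, he⟩ := he
      have hv := congrArg Fin.val (eq_of_heq he)
      have := j.isLt
      simp only at hv hd0
      omega
    · simp
    · rfl

/-! ### Polynomial bounds on signals and amplification coefficients -/

/-- A common bound for all channel gains. -/
noncomputable def gainBound (h : G.edgeSet → ℂ) : ℝ := ∏ e, (1 + ‖h e‖)

theorem one_le_gainBound (h : G.edgeSet → ℂ) : 1 ≤ gainBound h :=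
  Finset.prod_induction _ (1 ≤ ·) (fun _ _ => one_le_mul_of_one_le_of_one_le) le_rfl
    fun _ _ => le_add_of_nonneg_right (norm_nonneg _)

theorem norm_chan_le (h : G.edgeSet → ℂ) (v w : Fin (K + 2)) : ‖chan h v w‖ ≤ gainBound h := by
  unfold chan
  split_ifs with hvw
  · refine (le_add_of_nonneg_left zero_le_one).trans ?_
    rw [gainBound, ← Finset.mul_prod_erase _ _ (Finset.mem_univ (⟨s(v, w), hvw⟩ : G.edgeSet))]
    refine le_mul_of_one_le_right (by positivity) ?_
    exact Finset.prod_induction _ (1 ≤ ·) (fun _ _ => one_le_mul_of_one_le_of_one_le) le_rfl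
      fun _ _ => le_add_of_nonneg_right (norm_nonneg _)
  · simpa using zero_le_one.trans (one_le_gainBound h)

/-- A common bound for all coefficients of the signals. -/
noncomputable def signalBound (c : RSScheme G L S) (h : G.edgeSet → ℂ) : ℝ :=
  ((1 + Fintype.card c.Hop) * gainBound h) ^ S

theorem gainBound_le_signalBound (c : RSScheme G L S) (a : c.Hop) (h : G.edgeSet → ℂ) :
    gainBound h ≤ c.signalBound h := by
  have h1 := one_le_gainBound h
  have h2 : gainBound h ≤ (1 + Fintype.card c.Hop) * gainBound h :=
    le_mul_of_one_le_left (by linarith) (le_add_of_nonneg_right (Nat.cast_nonneg _))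
  exact h2.trans (le_self_pow₀ (h1.trans h2) (c.slot_pos a).ne')

theorem amplification_nonneg (c : RSScheme G L S) (rule : PowerRule) (P : ℝ)
    (h : G.edgeSet → ℂ) (a : c.Hop) (z : Fin L ⊕ c.Hop → ℂ) :
    0 ≤ c.amplification rule P h a z := le_min zero_le_one (Real.sqrt_nonneg _)

theorem norm_amplification_mul_le (c : RSScheme G L S) (rule : PowerRule) (P : ℝ)
    (h : G.edgeSet → ℂ) (a : c.Hop) (z : Fin L ⊕ c.Hop → ℂ) (w : Circle) :
    ‖(c.amplification rule P h a z : ℂ) * (w : ℂ)‖ ≤ 1 := by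
  rw [norm_mul, Circle.norm_coe, mul_one, Complex.norm_real, Real.norm_eq_abs,
    abs_of_nonneg (c.amplification_nonneg ..)]
  exact min_le_left _ _

/-- Amplification coefficients are at most `1`, so each slot enlarges the coefficients at most by
the factor `D`. -/
theorem norm_received_le (c : RSScheme G L S) (rule : PowerRule) (P : ℝ) (h : G.edgeSet → ℂ)
    (u : c.Hop → Circle) (a : c.Hop) (k : Fin L ⊕ c.Hop) :
    ‖c.received rule P h u a k‖ ≤ c.signalBound h := by
  set D : ℝ := (1 + Fintype.card c.Hop) * gainBound h with hD
  have hT := one_le_gainBound h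
  have hD1 : 1 ≤ D := one_le_mul_of_one_le_of_one_le
    (le_add_of_nonneg_right (Nat.cast_nonneg _)) hT
  -- Slots are numbered from `0`, so the exponent is at most `S`.
  suffices hs : ‖c.received rule P h u a k‖ ≤ D ^ ((c.hopSlot a).val + 1) from
    hs.trans (pow_le_pow_right₀ hD1 (c.hopSlot a).isLt)
  induction a using c.hop_induction with
  | hp a ih =>
    have hDs : 1 ≤ D ^ (c.hopSlot a).val := one_le_pow₀ hD1
    have hsingle : ∀ x : Fin L ⊕ c.Hop, ‖(Pi.single x 1 : Fin L ⊕ c.Hop → ℂ) k‖ ≤ 1 := by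
      intro x
      by_cases hx : k = x
      · subst hx; simp
      · simp [Pi.single_eq_of_ne hx]
    rw [received_apply]
    calc _ ≤ 1 + ∑ b : c.Hop, gainBound h * D ^ (c.hopSlot a).val := by
          refine (norm_add_le _ _).trans (add_le_add (hsingle _) ?_)
          refine (norm_sum_le _ _).trans (Finset.sum_le_sum fun b _ => ?_)
          split_ifs with hb hb0
          · rw [norm_mul, norm_mul]
            refine mul_le_mul (norm_chan_le h _ _) ?_ (by positivity) (by linarith)
            have hlt : (c.hopSlot (c.prevHop b)).val < (c.hopSlot a).val :=
              hb ▸ c.hopSlot_prevHop b hb0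
            calc _ ≤ 1 * D ^ ((c.hopSlot (c.prevHop b)).val + 1) :=
                  mul_le_mul (c.norm_amplification_mul_le ..) (ih b hb hb0) (norm_nonneg _)
                    zero_le_one
              _ ≤ _ := by
                rw [one_mul]
                exact pow_le_pow_right₀ hD1 hlt
          · rw [norm_mul]
            exact mul_le_mul (norm_chan_le h _ _) ((hsingle _).trans hDs) (norm_nonneg _)
              (by linarith)
          · rw [norm_zero]
            positivity
      _ ≤ _ := by
          rw [Finset.sum_const, Finset.card_univ, nsmul_eq_mul, pow_succ]
          nlinarith [mul_le_mul hT hDs zero_le_one (by linarith)]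

/-- A bound for the received powers, relative to the transmitted power. -/
noncomputable def powerBound (c : RSScheme G L S) (h : G.edgeSet → ℂ) : ℝ :=
  (L + Fintype.card c.Hop + 1) * c.signalBound h ^ 2

theorem signalBound_pos (c : RSScheme G L S) (h : G.edgeSet → ℂ) : 0 < c.signalBound h := by
  have := one_le_gainBound h
  unfold signalBound
  positivity

theorem one_le_powerBound (c : RSScheme G L S) (a : c.Hop) (h : G.edgeSet → ℂ) :
    1 ≤ c.powerBound h := by
  have h1 := (one_le_gainBound h).trans (c.gainBound_le_signalBound a h)
  refine one_le_mul_of_one_le_of_one_le ?_ (one_le_pow₀ h1)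
  have : (0 : ℝ) ≤ L + Fintype.card c.Hop := by positivity
  linarith

/-- Under either rule the received power is at most `P * powerBound`, the noise being absorbed by `P
≥ 1`. Only here do the two rules need separate treatment. -/
theorem inv_powerBound_le_sq_amplification (c : RSScheme G L S) (rule : PowerRule) {P : ℝ}
    (hP : 1 ≤ P) (h : G.edgeSet → ℂ) (u : c.Hop → Circle) (a : c.Hop) :
    (c.powerBound h)⁻¹ ≤ c.amplification rule P h a (c.received rule P h u a) ^ 2 := by
  have hV := c.one_le_powerBound a h
  have hB := c.signalBound_pos h
  have hTB := c.gainBound_le_signalBound a h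
  have hT := one_le_gainBound h
  have key : ∀ W : ℝ, 0 < W → W ≤ P * c.powerBound h → (c.powerBound h)⁻¹ ≤ min 1 √(P / W) ^ 2 := by
    intro W hW hWP
    rw [← Real.sqrt_le_left (le_min zero_le_one (Real.sqrt_nonneg _))]
    refine le_min (Real.sqrt_le_one.2 (inv_le_one_of_one_le₀ hV)) (Real.sqrt_le_sqrt ?_)
    rw [inv_eq_one_div, div_le_div_iff₀ (by linarith) hW, one_mul]
    exact hWP
  unfold amplification
  cases rule with
  | exact =>
    refine key _ ?_ ?_
    · refine add_pos_of_nonneg_of_pos (by positivity) ?_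
      refine Finset.sum_pos' (fun _ _ => by positivity) ⟨a, Finset.mem_univ _, ?_⟩
      rw [received_inr_self]
      simp
    · calc c.signalPower P (c.received .exact P h u a)
          ≤ P * ∑ _l : Fin L, c.signalBound h ^ 2 + ∑ _a : c.Hop, c.signalBound h ^ 2 := by
            unfold signalPower
            gcongr <;> exact c.norm_received_le ..
        _ ≤ _ := by
            rw [Finset.sum_const, Finset.sum_const, Finset.card_univ, Finset.card_univ,
              Fintype.card_fin, nsmul_eq_mul, nsmul_eq_mul, powerBound]
            have h1 : (Fintype.card c.Hop : ℝ) * c.signalBound h ^ 2 ≤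
                P * (Fintype.card c.Hop * c.signalBound h ^ 2) :=
              le_mul_of_one_le_left (by positivity) hP
            have h2 : 0 ≤ P * c.signalBound h ^ 2 := by positivity
            nlinarith
  | nominal =>
    refine key _ ?_ ?_
    · refine add_pos_of_pos_of_nonneg one_pos (mul_nonneg (by linarith) ?_)
      exact Finset.sum_nonneg fun b _ => by split_ifs <;> positivity
    · calc c.nominalPower P h a ≤ 1 + P * ∑ _b : c.Hop, c.signalBound h ^ 2 := by
            unfold nominalPower
            gcongr with b _
            split_ifs
            · exact pow_le_pow_left₀ (norm_nonneg _) ((norm_chan_le h _ _).trans hTB) 2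
            · positivity
        _ ≤ _ := by
            rw [Finset.sum_const, Finset.card_univ, nsmul_eq_mul, powerBound]
            have h1 : 1 ≤ P * c.signalBound h ^ 2 :=
              one_le_mul_of_one_le_of_one_le hP (one_le_pow₀ (hT.trans hTB))
            have h2 : 0 ≤ P * (L * c.signalBound h ^ 2) := by positivity
            nlinarith

/-- The end-to-end gain of a path is the product of its channel gains, up to bounded factors. -/
theorem prod_le_sq_norm_received (c : RSScheme G L S) (rule : PowerRule) {P : ℝ}
    (hP : 1 ≤ P) (h : G.edgeSet → ℂ) (u : c.Hop → Circle) (i : Fin L) (n : ℕ)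
    (hn : n < (c.path i).1.length) :
    ∏ j : Fin (n + 1), ‖h (c.hopEdge ⟨i, j.castLE hn⟩)‖ ^ 2 / c.powerBound h ≤
      ‖c.received rule P h u ⟨i, n, hn⟩ (.inl i)‖ ^ 2 := by
  have hV := c.one_le_powerBound ⟨i, n, hn⟩ h
  induction n with
  | zero =>
    rw [c.received_inl_self rule P h u ⟨i, 0, hn⟩]
    -- The transmitter does not amplify; the divisor, at least `1`, is harmless and keeps the
    -- product uniform in the hops.
    calc _ = ‖h (c.hopEdge ⟨i, 0, hn⟩)‖ ^ 2 / c.powerBound h := Fin.prod_univ_one _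
      _ ≤ _ := by simpa using div_le_self (sq_nonneg _) hV
  | succ n ih =>
    rw [Fin.prod_univ_castSucc, c.received_inl_self rule P h u ⟨i, n + 1, hn⟩, if_pos n.succ_pos]
    have h1 := ih (Nat.lt_of_succ_lt hn)
    have h2 := c.inv_powerBound_le_sq_amplification rule hP h u ⟨i, n, Nat.lt_of_succ_lt hn⟩
    have hprev : c.prevHop ⟨i, n + 1, hn⟩ = ⟨i, n, Nat.lt_of_succ_lt hn⟩ := rfl
    rw [hprev, norm_mul, norm_mul, norm_mul, Circle.norm_coe, mul_one, Complex.norm_real,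
      Real.norm_eq_abs, mul_pow, mul_pow, sq_abs, mul_comm, div_eq_mul_inv, mul_assoc]
    have h3 : (c.powerBound h)⁻¹ * ∏ j : Fin (n + 1), ‖h (c.hopEdge ⟨i, j.castLE (Nat.lt_of_succ_lt hn)⟩)‖ ^ 2 /
        c.powerBound h ≤ _ :=
      mul_le_mul h2 h1 (Finset.prod_nonneg fun _ _ => by positivity) (sq_nonneg _)
    exact mul_le_mul_of_nonneg_left h3 (sq_nonneg _)

end RSScheme

/-! ### Edge loads and the outage event -/

namespace RSScheme

variable {K : ℕ} {G : RelayGraph K} {L S : ℕ}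

/-- A self-avoiding path crosses an edge at most once, so hops over `e` inject into paths through
`e`. -/
theorem card_hopEdge_eq_le_load (c : RSScheme G L S) [DecidableEq G.edgeSet] (e : G.edgeSet) :
    (Finset.univ.filter fun a : c.Hop => c.hopEdge a = e).card ≤ c.load e := by
  refine Finset.card_le_card_of_injOn (fun a => a.1) ?_ ?_
  · intro a ha
    obtain rfl := (Finset.mem_filter.1 ha).2
    refine Finset.mem_filter.2 ⟨Finset.mem_univ _, ?_⟩
    exact (SimpleGraph.Walk.mk_mem_edges_iff_exists _).2 ⟨a.2.val, a.2.isLt, Sym2.eq_swap⟩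
  · rintro ⟨i, j⟩ ha ⟨i', j'⟩ hb hab
    obtain rfl : i = i' := hab
    have he : c.hopEdge ⟨i, j⟩ = c.hopEdge ⟨i, j'⟩ :=
      (Finset.mem_filter.1 ha).2.trans (Finset.mem_filter.1 hb).2.symm
    have he' : s(c.rx ⟨i, j⟩, c.tx ⟨i, j⟩) = s(c.rx ⟨i, j'⟩, c.tx ⟨i, j'⟩) := congrArg Subtype.val he
    have hinj := (c.path i).2.getVert_injOn
    have hj := j.isLt
    have hj' := j'.isLt
    have hval : j.val = j'.val := by
      rcases Sym2.eq_iff.1 he' with ⟨-, h2⟩ | ⟨h1, h2⟩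
      · exact hinj (show j.val ≤ _ by omega) (show j'.val ≤ _ by omega) h2
      -- Crossing the edge in opposite directions would give both `j + 1 = j'` and `j = j' + 1`.
      · have e1 := hinj (show j.val + 1 ≤ _ by omega) (show j'.val ≤ _ by omega) h1
        have e2 := hinj (show j.val ≤ _ by omega) (show j'.val + 1 ≤ _ by omega) h2
        omega
    rw [Fin.ext hval]

variable [DecidableRel G.Adj]

theorem load_le_maxLoad (c : RSScheme G L S) (e : G.edgeSet) : c.load e ≤ c.maxLoad :=
  Finset.le_sup (f := c.load) (SimpleGraph.mem_edgeFinset.2 e.2)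

/-- The determinant of the end-to-end channel is a product of channel gains, up to bounded
factors. -/
theorem prod_le_sq_norm_det_channelMatrix (c : RSScheme G L S) (rule : PowerRule) {P : ℝ}
    (hP : 1 ≤ P) (h : G.edgeSet → ℂ) (u : c.Hop → Circle) :
    ∏ a : c.Hop, ‖h (c.hopEdge a)‖ ^ 2 / c.powerBound h ≤
      ‖(c.channelMatrix rule P h u).det‖ ^ 2 := by
  have htri : (c.channelMatrix rule P h u).IsLowerTriangular := fun i l hil =>
    c.received_inl_of_lt rule P h u (c.lastHop i) (l := l) hil
  rw [Matrix.det_of_isLowerTriangular _ htri, norm_prod, ← Finset.prod_pow, Fintype.prod_sigma]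
  have hV : ∀ a : c.Hop, 0 ≤ c.powerBound h := fun a =>
    zero_le_one.trans (c.one_le_powerBound a h)
  refine Finset.prod_le_prod (fun i _ => Finset.prod_nonneg fun j _ =>
    div_nonneg (sq_nonneg _) (hV ⟨i, j⟩)) fun i _ => ?_
  have hlen := Nat.sub_add_cancel (c.length_pos i)
  refine le_of_eq_of_le ?_ (c.prod_le_sq_norm_received rule hP h u i _
    (Nat.sub_lt (c.length_pos i) Nat.one_pos))
  exact (Fintype.prod_equiv (finCongr hlen) _ _ fun j => rfl).symm

-- The receiver noise of path `i` occurs in output `i` alone, with coefficient `1`. Thus `Q`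
-- contains an identity block and its rows are independent.
open scoped ComplexOrder in
theorem posDef_noiseMatrix_mul_conjTranspose (c : RSScheme G L S) (rule : PowerRule) (P : ℝ)
    (h : G.edgeSet → ℂ) (u : c.Hop → Circle) :
    (c.noiseMatrix rule P h u * (c.noiseMatrix rule P h u).conjTranspose).PosDef := by
  refine Matrix.PosDef.mul_conjTranspose_self _ fun v w hvw => funext fun i => ?_
  have key : ∀ v : Fin L → ℂ,
      Matrix.vecMul v (c.noiseMatrix rule P h u) (c.lastHop i) = v i := by
    intro v
    rw [Matrix.vecMul, dotProduct, Finset.sum_eq_single i]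
    · simp [noiseMatrix, received_inr_self]
    · intro j _ hj
      have hne : c.lastHop i ≠ c.lastHop j := fun he => hj (congrArg Sigma.fst he).symm
      simp [noiseMatrix, c.received_inr_lastHop rule P h u _ hne]
    · simp
  rw [← key v, ← key w]
  exact congrFun hvw _

/-- The Leibniz expansion has `L!` terms, and each matrix entry is a sum over the hops. -/
theorem norm_det_noise_le (c : RSScheme G L S) (rule : PowerRule) (P : ℝ)
    (h : G.edgeSet → ℂ) (u : c.Hop → Circle) :
    ‖(c.noiseMatrix rule P h u * (c.noiseMatrix rule P h u).conjTranspose).det‖ ≤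
      L.factorial * ((1 + Fintype.card c.Hop) * c.signalBound h ^ 2) ^ L := by
  have hB := c.signalBound_pos h
  have := Matrix.det_le (abv := NormedField.toAbsoluteValue ℂ)
    (A := c.noiseMatrix rule P h u * (c.noiseMatrix rule P h u).conjTranspose)
    (x := (1 + Fintype.card c.Hop) * c.signalBound h ^ 2) fun i j => ?_
  · rwa [nsmul_eq_mul, Fintype.card_fin] at this
  · change ‖(c.noiseMatrix rule P h u * (c.noiseMatrix rule P h u).conjTranspose) i j‖ ≤ _
    rw [Matrix.mul_apply]
    calc _ ≤ ∑ _a : c.Hop, c.signalBound h ^ 2 := by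
          refine (norm_sum_le _ _).trans (Finset.sum_le_sum fun a _ => ?_)
          rw [norm_mul, Matrix.conjTranspose_apply, norm_star, sq]
          exact mul_le_mul (c.norm_received_le ..) (c.norm_received_le ..) (norm_nonneg _) hB.le
      _ ≤ _ := by
          rw [Finset.sum_const, Finset.card_univ, nsmul_eq_mul]
          gcongr
          linarith

/-- In outage, the product of the channel gains, with the multiplicities of their use, is small. -/
theorem exists_prod_le_of_outage (c : RSScheme G L S) (hL : 0 < L) [DecidableEq G.edgeSet] :
    ∃ (C : ℝ) (m : ℕ), 0 < C ∧ ∀ (rule : PowerRule) (P R : ℝ) (h : G.edgeSet → ℂ)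
      (u : c.Hop → Circle), 1 ≤ P → c.mutualInfo rule P h u ≤ S * R →
      ∏ e, ‖h e‖ ^ (2 * (Finset.univ.filter fun a : c.Hop => c.hopEdge a = e).card) ≤
        (C * 2 ^ (S * R) / P ^ L) * ∏ e, (1 + ‖h e‖) ^ m := by
  set n := Fintype.card c.Hop with hn
  -- Numerical factors and exponent of `gainBound` in the bound for `det N` times `powerBound ^ n`.
  refine ⟨L.factorial * (1 + n) ^ L * (1 + n) ^ (S * (2 * L)) * (L + n + 1) ^ n *
    (1 + n) ^ (S * (2 * n)), S * (2 * L) + S * (2 * n), by positivity,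
    fun rule P R h u hP hout => ?_⟩
  have hP0 : 0 < P := by linarith
  have hX : ∏ e, ‖h e‖ ^ (2 * (Finset.univ.filter fun a : c.Hop => c.hopEdge a = e).card) =
      ∏ a : c.Hop, ‖h (c.hopEdge a)‖ ^ 2 := by
    rw [← Finset.prod_fiberwise' Finset.univ c.hopEdge fun e => ‖h e‖ ^ 2]
    refine Finset.prod_congr rfl fun e _ => ?_
    rw [Finset.prod_const, pow_mul]
  have hV : 0 < c.powerBound h :=
    one_pos.trans_le (c.one_le_powerBound (c.lastHop ⟨0, hL⟩) h)
  have hT := one_le_gainBound h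
  have hdet := c.prod_le_sq_norm_det_channelMatrix rule hP h u
  rw [Finset.prod_div_distrib, Finset.prod_const, Finset.card_univ, ← hn,
    div_le_iff₀ (by positivity)] at hdet
  rw [hX, Finset.prod_pow Finset.univ _ fun e => 1 + ‖h e‖,
    show ∏ e, (1 + ‖h e‖) = gainBound h from rfl, div_mul_eq_mul_div, le_div_iff₀ (by positivity)]
  set N := c.noiseMatrix rule P h u * (c.noiseMatrix rule P h u).conjTranspose with hN
  have hbound : P ^ L * ‖(c.channelMatrix rule P h u).det‖ ^ 2 ≤
      2 ^ (S * R) * (L.factorial * ((1 + n) * c.signalBound h ^ 2) ^ L) := by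
    -- The determinant inequality needs an invertible channel; otherwise the left side is `0`.
    by_cases h0 : (c.channelMatrix rule P h u).det = 0
    · rw [h0, norm_zero]
      have := c.signalBound_pos h
      simp only [ne_eq, OfNat.ofNat_ne_zero, not_false_eq_true, zero_pow, mul_zero]
      positivity
    · have h1 := (c.posDef_noiseMatrix_mul_conjTranspose rule P h u).le_re_det_one_add h0 hP0.le
      rw [Fintype.card_fin] at h1
      have hpos : 0 < P ^ L * ‖(c.channelMatrix rule P h u).det‖ ^ 2 := by
        have := norm_pos_iff.2 h0
        positivity
      have hre := pos_of_mul_pos_left (hpos.trans_le h1) (norm_nonneg _)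
      refine h1.trans (mul_le_mul ?_ (c.norm_det_noise_le rule P h u) (norm_nonneg _)
        (by positivity))
      exact (Real.logb_le_iff_le_rpow one_lt_two hre).1 hout
  calc _ ≤ ‖(c.channelMatrix rule P h u).det‖ ^ 2 * c.powerBound h ^ n * P ^ L := by gcongr
    _ = P ^ L * ‖(c.channelMatrix rule P h u).det‖ ^ 2 * c.powerBound h ^ n := by ring
    _ ≤ 2 ^ (S * R) * (L.factorial * ((1 + n) * c.signalBound h ^ 2) ^ L) *
        c.powerBound h ^ n := by gcongr
    _ = _ := by
        rw [powerBound, signalBound, ← hn]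
        simp only [mul_pow, ← pow_mul, pow_add, mul_assoc]
        ring

/-! ### Decay of the outage probability and the diversity gain -/

/-- The outage probability decays like `(2 ^ (S R) / P ^ L) ^ s` for all `s < 1 / maxLoad`. -/
theorem exists_outageProb_le (c : RSScheme G L S) (hL : 0 < L) {s : ℝ} (hs : 0 ≤ s)
    (hsM : s * c.maxLoad < 1) :
    ∃ C D : ℝ, 0 < C ∧ 0 < D ∧ ∀ (rule : PowerRule) (P R : ℝ), 1 ≤ P →
      c.outageProb rule P R ≤ ENNReal.ofReal (D * (C * 2 ^ (S * R) / P ^ L) ^ s) := by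
  classical
  obtain ⟨C, m, hC, hout⟩ := c.exists_prod_le_of_outage hL
  obtain ⟨D, hD, hprob⟩ := exists_measure_prod_enorm_le
    (fun e : G.edgeSet => (Finset.univ.filter fun a : c.Hop => c.hopEdge a = e).card) m hs
    fun e => lt_of_le_of_lt (mul_le_mul_of_nonneg_left (Nat.cast_le.2
      ((c.card_hopEdge_eq_le_load e).trans (c.load_le_maxLoad e))) hs) hsM
  refine ⟨C, D, hC, hD, fun rule P R hP => ?_⟩
  have hP0 : 0 < P := by linarith
  refine le_trans ?_ (hprob (C * 2 ^ (S * R) / P ^ L) (by positivity))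
  have : IsProbabilityMeasure ((volume : Measure ℝ).restrict (Set.Ioc 0 1)) := ⟨by simp⟩
  set A := {h : G.edgeSet → ℂ | ∏ e, ‖h e‖ ^
    (2 * (Finset.univ.filter fun a : c.Hop => c.hopEdge a = e).card) ≤
      (C * 2 ^ (S * R) / P ^ L) * ∏ e, (1 + ‖h e‖) ^ m} with hA
  have hAm : MeasurableSet A := measurableSet_le (by fun_prop) (by fun_prop)
  -- Monotonicity needs no measurability of the outage set; the larger set is a cylinder over the
  -- gains.
  calc c.outageProb rule P R ≤ c.law (Prod.fst ⁻¹' A) :=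
        measure_mono fun ω hω => hout rule P R ω.1 _ hP hω
    _ = _ := measurePreserving_fst.measure_preimage hAm.nullMeasurableSet

theorem outageProb_le_one (c : RSScheme G L S) (rule : PowerRule) (P R : ℝ) :
    c.outageProb rule P R ≤ 1 := by
  have : IsProbabilityMeasure ((volume : Measure ℝ).restrict (Set.Ioc 0 1)) := ⟨by simp⟩
  have : IsProbabilityMeasure c.law := by unfold law; infer_instance
  exact prob_le_one

theorem coe_le_neg_log_div_log {p : ENNReal} {P a : ℝ} (hP : 1 < P)
    (h : p.log ≤ ((-(a * Real.log P) : ℝ) : EReal)) :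
    (a : EReal) ≤ -p.log / ((Real.log P : ℝ) : EReal) := by
  rw [EReal.le_div_iff_mul_le (by exact_mod_cast Real.log_pos hP) (EReal.coe_ne_top _),
    ← EReal.coe_mul, EReal.le_neg]
  exact_mod_cast h

theorem zero_le_diversityGain (c : RSScheme G L S) (rule : PowerRule) (R : ℝ → ℝ) :
    0 ≤ c.diversityGain rule R := by
  refine le_liminf_of_le (by isBoundedDefault) ?_
  filter_upwards [eventually_gt_atTop 1] with P hP
  exact coe_le_neg_log_div_log (a := 0) hP (by simpa using c.outageProb_le_one rule P (R P))

/-- On the scale of `log P` the constants `D` and `C ^ s` disappear, and the exponent tends to `s *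
(L - S * r)`. -/
theorem mul_le_diversityGain (c : RSScheme G L S) (hL : 0 < L) (rule : PowerRule) {r : ℝ}
    {R : ℝ → ℝ} (hR : Tendsto (fun P => R P / Real.logb 2 P) atTop (𝓝 r)) {s a : ℝ}
    (hs : 0 ≤ s) (hsM : s * c.maxLoad < 1) (ha : a < s * (L - S * r)) :
    (a : EReal) ≤ c.diversityGain rule R := by
  obtain ⟨C, D, hC, hD, hprob⟩ := c.exists_outageProb_le hL hs hsM
  refine le_liminf_of_le (by isBoundedDefault) ?_
  have hlim : Tendsto (fun P => s * (L - S * (R P / Real.logb 2 P)) -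
      (Real.log D + s * Real.log C) / Real.log P) atTop (𝓝 (s * (L - S * r) - 0)) :=
    (((hR.const_mul _).const_sub _).const_mul _).sub
      (tendsto_const_nhds.div_atTop Real.tendsto_log_atTop)
  rw [sub_zero] at hlim
  filter_upwards [eventually_gt_atTop 1, hlim.eventually_const_lt ha] with P hP haP
  have hP0 : 0 < P := by linarith
  have hlog := Real.log_pos hP
  refine coe_le_neg_log_div_log hP ((ENNReal.log_monotone (hprob rule P (R P) hP.le)).trans ?_)
  rw [ENNReal.log_ofReal_of_pos (by positivity), EReal.coe_le_coe_iff,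
    Real.log_mul (by positivity) (by positivity), Real.log_rpow (by positivity),
    Real.log_div (by positivity) (by positivity), Real.log_mul (by positivity) (by positivity),
    Real.log_rpow two_pos, Real.log_pow]
  have hmul := mul_lt_mul_of_pos_right haP hlog
  have hlog2 := Real.log_pos one_lt_two
  have e1 : (s * (L - S * (R P / Real.logb 2 P)) - (Real.log D + s * Real.log C) / Real.log P) *
      Real.log P = s * (L * Real.log P - S * (R P * Real.log 2)) -
        (Real.log D + s * Real.log C) := by
    rw [Real.logb]
    field_simp
  rw [e1] at hmul
  nlinarith

end RSScheme

theorem theorem4 {K L S : ℕ} (G : RelayGraph K) [DecidableRel G.Adj] (hL : 0 < L)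
    (c : RSScheme G L S) (rule : PowerRule) (r : ℝ) (hr : 0 ≤ r) (R : ℝ → ℝ)
    (hR : Tendsto (fun P => R P / Real.logb 2 P) atTop (𝓝 r)) :
    (((L : ℝ) / (c.maxLoad : ℝ) * max (1 - (S : ℝ) / (L : ℝ) * r) 0 : ℝ) : EReal) ≤
      c.diversityGain rule R := by
  have hL' : (0 : ℝ) < L := Nat.cast_pos.2 hL
  -- In both cases the claimed bound is `0`; for `maxLoad = 0` by the convention for division by
  -- zero.
  by_cases h0 : c.maxLoad = 0 ∨ (L : ℝ) - S * r ≤ 0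
  · refine le_of_eq_of_le ?_ (c.zero_le_diversityGain rule R)
    rcases h0 with h0 | h0
    · simp [h0]
    · rw [max_eq_right, mul_zero, EReal.coe_zero]
      rw [div_mul_eq_mul_div, sub_nonpos, le_div_iff₀ hL']
      linarith
  · push Not at h0
    obtain ⟨hM, hd⟩ := h0
    have hM' : (0 : ℝ) < c.maxLoad := Nat.cast_pos.2 (Nat.pos_of_ne_zero hM)
    refine EReal.ge_of_forall_gt_iff_ge.1 fun a ha => ?_
    have ha' : a < (L - S * r) / c.maxLoad := by
      refine (EReal.coe_lt_coe_iff.1 ha).trans_eq ?_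
      rw [max_eq_left]
      · field_simp
      · rw [div_mul_eq_mul_div, sub_nonneg, div_le_one hL']
        linarith
    -- Any `s` strictly between these numbers is an admissible Chernoff exponent; the maximum with
    -- `0` covers negative `a`.
    have h1 : max 0 (a / (L - S * r)) < 1 / c.maxLoad := by
      refine max_lt (by positivity) ?_
      rw [div_lt_div_iff₀ hd hM', one_mul]
      exact (lt_div_iff₀ hM').1 ha'
    obtain ⟨s, hs1, hs2⟩ := exists_between h1
    exact c.mul_le_diversityGain hL rule hR ((le_max_left _ _).trans hs1.le)
      ((lt_div_iff₀ hM').1 hs2) ((div_lt_iff₀ hd).1 ((le_max_right _ _).trans_lt hs1))
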